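/- Let $(X,\mathcal U)$ be a (Hausdorff) uniform space. Assume that $(X,\mathcal U)$ is - $\omega$-narrow: for every entourage $U\in\mathcal U$ there is a countable set $A\subseteq X$ with $X=\bigcup_{a\in A}\{x\in X:(a,x)\in U\}$; and - a uniform $P$-space: the intersection of every countable family of entourages in $\mathcal U$ is again an entourage in $\mathcal U$. (Equivalently, every countable subset of $\mathcal U$, ordered by reverse inclusion, is bounded; that is, $\operatorname{add}(\mathcal U)>\omega$ or $\mathcal U$ has a smallest entourage.) Let $F(X,\mathcal U)$ (respectively $A(X,\mathcal U)$) be the free topological group (respectively free Abelian topological group) over $(X,\mathcal U)$, i.e. the free (respectively free Abelian) group on the set $X$ with the finest group topology for which the insertion of generators is uniformly continuous with respect to the two-sided uniformity of the group; equivalently, the insertion of generators is uniformly continuous and every uniformly continuous map from $(X,\mathcal U)$ to a topological (respectively topological Abelian) group, with its two-sided uniformity, extends uniquely to a continuous homomorphism. For a topological group $G$ let $\mathcal N_e(G)$ be the neighbourhood filter of its identity; order $\mathcal N_e(G)$ and $\mathcal U$ by reverse inclusion. For directed pre-ordered sets $P,Q$ write $P\le_T Q$ if there is a map $Q\to P$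 sending cofinal subsets of $Q$ to cofinal subsets of $P$, and $P=_TQ$ if $P\le_TQ$ and $Q\le_TP$. Then \[ \mathcal N_e(F(X,\mathcal U))=_T\mathcal N_e(A(X,\mathcal U))=_T\mathcal U . \] -/

import Mathlib

open scoped Uniformity Topology

/-! ### Tukey order -/

/-- `P ≤_T Q`: there is a map `Q → P` sending cofinal subsets of `Q` to cofinal subsets of `P`. -/
def TukeyLE (P Q : Type*) [Preorder P] [Preorder Q] : Prop :=
  ∃ φ : Q → P, ∀ C : Set Q, IsCofinal C → IsCofinal (φ '' C)

/-- Tukey equivalence `P =_T Q`. -/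
def TukeyEquiv (P Q : Type*) [Preorder P] [Preorder Q] : Prop :=
  TukeyLE P Q ∧ TukeyLE Q P

/-- The members of a filter, ordered by reverse inclusion: `U ≤ V` iff `V ⊆ U`. -/
abbrev FilterPoset {α : Type*} (l : Filter α) : Type _ := {U : Set α // U ∈ l}ᵒᵈ

/-! ### Classes of uniform spaces -/

/-- `X` is `ω`-narrow: for every entourage `U`, countably many `U`-balls cover `X`. -/
def IsOmegaNarrow (X : Type*) [UniformSpace X] : Prop :=
  ∀ U ∈ 𝓤 X, ∃ A : Set X, A.Countable ∧ ⋃ a ∈ A, UniformSpace.ball a U = Set.univ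

/-- `X` is a uniform `P`-space: countable intersections of entourages are entourages. -/
def IsUniformPSpace (X : Type*) [UniformSpace X] : Prop :=
  ∀ S : Set (Set (X × X)), S.Countable → (∀ U ∈ S, U ∈ 𝓤 X) → ⋂₀ S ∈ 𝓤 X

/-- Uniform `P`-spaces are those with no countable unbounded family of entourages. -/
theorem isUniformPSpace_iff (X : Type*) [UniformSpace X] :
    IsUniformPSpace X ↔ ∀ S : Set (FilterPoset (𝓤 X)), S.Countable → BddAbove S := by
  constructor
  · intro h S hS
    refine ⟨OrderDual.toDual ⟨⋂₀ ((fun U : FilterPoset (𝓤 X) => (OrderDual.ofDual U).1) '' S),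
      h _ (hS.image _) ?_⟩, ?_⟩
    · rintro _ ⟨U, -, rfl⟩
      exact (OrderDual.ofDual U).2
    · intro U hU
      exact Set.sInter_subset_of_mem (Set.mem_image_of_mem _ hU)
  · intro h S hS hmem
    obtain ⟨B, hB⟩ := h {U | (OrderDual.ofDual U).1 ∈ S}
      (hS.preimage (fun U V hUV => Subtype.ext hUV))
    refine Filter.mem_of_superset (OrderDual.ofDual B).2 (Set.subset_sInter fun U hU => ?_)
    exact hB (show OrderDual.toDual (⟨U, hmem U hU⟩ : {U // U ∈ 𝓤 X}) ∈ _ from hU)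

/-! ### Two-sided uniformities and free topological groups -/

/-- The two-sided uniformity of a topological group: the coarsest uniformity finer than the left
and the right uniformity. -/
@[reducible]
def twoSidedUniformSpace (G : Type*) [Group G] [TopologicalSpace G] [IsTopologicalGroup G] :
    UniformSpace G :=
  IsTopologicalGroup.leftUniformSpace G ⊓ IsTopologicalGroup.rightUniformSpace G

/-- The two-sided uniformity of an additive topological group. -/
@[reducible]
def addTwoSidedUniformSpace (G : Type*) [AddGroup G] [TopologicalSpace G]
    [IsTopologicalAddGroup G] : UniformSpace G :=
  IsTopologicalAddGroup.leftUniformSpace G ⊓ IsTopologicalAddGroup.rightUniformSpace G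

/-- `f` is uniformly continuous into the group `G` with the two-sided uniformity of the group
topology `t`. -/
def UniformContinuousTwoSided {X G : Type*} [UniformSpace X] [Group G] (t : GroupTopology G)
    (f : X → G) : Prop :=
  letI := t.toTopologicalSpace
  haveI := t.toIsTopologicalGroup
  @UniformContinuous X G _ (twoSidedUniformSpace G) f

/-- `f` is uniformly continuous into the additive group `G` with the two-sided uniformity of the
group topology `t`. -/
def AddUniformContinuousTwoSided {X G : Type*} [UniformSpace X] [AddGroup G]
    (t : AddGroupTopology G) (f : X → G) : Prop :=
  letI := t.toTopologicalSpace
  haveI := t.toIsTopologicalAddGroup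
  @UniformContinuous X G _ (addTwoSidedUniformSpace G) f

/-- The topology of `F(X, 𝓤)`: the finest group topology on the free group on `X` for which the
insertion of generators is uniformly continuous (in Mathlib's order on topologies, finer is
smaller). -/
def freeGroupTopology (X : Type*) [UniformSpace X] : GroupTopology (FreeGroup X) :=
  sInf {t | UniformContinuousTwoSided t (FreeGroup.of : X → FreeGroup X)}

/-- The topology of `A(X, 𝓤)`: the finest group topology on the free abelian group on `X` for which
the insertion of generators is uniformly continuous. -/
def freeAbelianGroupTopology (X : Type*) [UniformSpace X] : AddGroupTopology (FreeAbelianGroup X) :=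
  sInf {t | AddUniformContinuousTwoSided t (FreeAbelianGroup.of : X → FreeAbelianGroup X)}

theorem uniformContinuousTwoSided_iff {X G : Type*} [UniformSpace X] [Group G] (t : GroupTopology G)
    (f : X → G) : UniformContinuousTwoSided t f ↔
      Filter.Tendsto (fun p : X × X => (f p.1)⁻¹ * f p.2) (𝓤 X) (@nhds G t.toTopologicalSpace 1) ∧
      Filter.Tendsto (fun p : X × X => f p.2 * (f p.1)⁻¹) (𝓤 X)
        (@nhds G t.toTopologicalSpace 1) := by
  unfold UniformContinuousTwoSided UniformContinuous
  rw [inf_uniformity, Filter.tendsto_inf]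
  exact and_congr Filter.tendsto_comap_iff Filter.tendsto_comap_iff

theorem addUniformContinuousTwoSided_iff {X G : Type*} [UniformSpace X] [AddGroup G]
    (t : AddGroupTopology G) (f : X → G) : AddUniformContinuousTwoSided t f ↔
      Filter.Tendsto (fun p : X × X => -(f p.1) + f p.2) (𝓤 X) (@nhds G t.toTopologicalSpace 0) ∧
      Filter.Tendsto (fun p : X × X => f p.2 + -(f p.1)) (𝓤 X)
        (@nhds G t.toTopologicalSpace 0) := by
  unfold AddUniformContinuousTwoSided UniformContinuous
  rw [inf_uniformity, Filter.tendsto_inf]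
  exact and_congr Filter.tendsto_comap_iff Filter.tendsto_comap_iff

/-- The insertion of generators `X → F(X, 𝓤)` is uniformly continuous. -/
theorem uniformContinuousTwoSided_freeGroup_of (X : Type*) [UniformSpace X] :
    UniformContinuousTwoSided (freeGroupTopology X) (FreeGroup.of : X → FreeGroup X) := by
  rw [uniformContinuousTwoSided_iff]
  rw [freeGroupTopology, GroupTopology.toTopologicalSpace_sInf, nhds_sInf]
  simp only [Filter.tendsto_iInf, Set.mem_image]
  constructor <;> rintro _ ⟨t, ht, rfl⟩
  exacts [((uniformContinuousTwoSided_iff _ _).1 ht).1, ((uniformContinuousTwoSided_iff _ _).1 ht).2]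

/-- The insertion of generators `X → A(X, 𝓤)` is uniformly continuous. -/
theorem addUniformContinuousTwoSided_freeAbelianGroup_of (X : Type*) [UniformSpace X] :
    AddUniformContinuousTwoSided (freeAbelianGroupTopology X)
      (FreeAbelianGroup.of : X → FreeAbelianGroup X) := by
  rw [addUniformContinuousTwoSided_iff]
  rw [freeAbelianGroupTopology, AddGroupTopology.toTopologicalSpace_sInf, nhds_sInf]
  simp only [Filter.tendsto_iInf, Set.mem_image]
  constructor <;> rintro _ ⟨t, ht, rfl⟩
  exacts [((addUniformContinuousTwoSided_iff _ _).1 ht).1,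
    ((addUniformContinuousTwoSided_iff _ _).1 ht).2]

/-- Universal property of `F(X, 𝓤)`: uniformly continuous maps into topological groups extend to
continuous homomorphisms. -/
theorem continuous_freeGroup_lift {X G : Type*} [UniformSpace X] [Group G] (t : GroupTopology G)
    (f : X → G) (hf : UniformContinuousTwoSided t f) :
    @Continuous _ _ (freeGroupTopology X).toTopologicalSpace t.toTopologicalSpace
      (FreeGroup.lift f) := by
  let := t.toTopologicalSpace
  have := t.toIsTopologicalGroup
  let s : GroupTopology (FreeGroup X) :=
    ⟨TopologicalSpace.induced (FreeGroup.lift f) inferInstance, topologicalGroup_induced _⟩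
  have hs : UniformContinuousTwoSided s (FreeGroup.of : X → FreeGroup X) := by
    rw [uniformContinuousTwoSided_iff] at hf ⊢
    simpa [s, nhds_induced, Filter.tendsto_comap_iff, Function.comp_def] using hf
  have hle : freeGroupTopology X ≤ s := sInf_le hs
  exact continuous_iff_le_induced.2 hle

/-- Universal property of `A(X, 𝓤)`: uniformly continuous maps into topological abelian groups
extend to continuous homomorphisms. -/
theorem continuous_freeAbelianGroup_lift {X G : Type*} [UniformSpace X] [AddCommGroup G]
    (t : AddGroupTopology G) (f : X → G) (hf : AddUniformContinuousTwoSided t f) :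
    @Continuous _ _ (freeAbelianGroupTopology X).toTopologicalSpace t.toTopologicalSpace
      (FreeAbelianGroup.lift f) := by
  let := t.toTopologicalSpace
  have := t.toIsTopologicalAddGroup
  let s : AddGroupTopology (FreeAbelianGroup X) :=
    ⟨TopologicalSpace.induced (FreeAbelianGroup.lift f) inferInstance,
      topologicalAddGroup_induced _⟩
  have hs : AddUniformContinuousTwoSided s (FreeAbelianGroup.of : X → FreeAbelianGroup X) := by
    rw [addUniformContinuousTwoSided_iff] at hf ⊢
    simpa [s, nhds_induced, Filter.tendsto_comap_iff, Function.comp_def] using hf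
  have hle : freeAbelianGroupTopology X ≤ s := sInf_le hs
  exact continuous_iff_le_induced.2 hle

/-- `N_e(F(X, 𝓤))`, ordered by reverse inclusion. -/
abbrev FreeGroupNhds (X : Type*) [UniformSpace X] : Type _ :=
  FilterPoset (@nhds (FreeGroup X) (freeGroupTopology X).toTopologicalSpace 1)

/-- `N_e(A(X, 𝓤))`, ordered by reverse inclusion. -/
abbrev FreeAbelianGroupNhds (X : Type*) [UniformSpace X] : Type _ :=
  FilterPoset (@nhds (FreeAbelianGroup X) (freeAbelianGroupTopology X).toTopologicalSpace 0)

/-! ### Monotone cofinal maps between filters -/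

/-- A monotone map with cofinal range witnesses the Tukey order. -/
theorem TukeyLE.of_monotone {P Q : Type*} [Preorder P] [Preorder Q] (φ : Q → P) (hφ : Monotone φ)
    (h : ∀ p, ∃ q, p ≤ φ q) : TukeyLE P Q := by
  refine ⟨φ, fun C hC p => ?_⟩
  obtain ⟨q, hq⟩ := h p
  obtain ⟨c, hc, hqc⟩ := hC q
  exact ⟨φ c, Set.mem_image_of_mem φ hc, hq.trans (hφ hqc)⟩

theorem TukeyLE.trans {P Q R : Type*} [Preorder P] [Preorder Q] [Preorder R]
    (h₁ : TukeyLE P Q) (h₂ : TukeyLE Q R) : TukeyLE P R := by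
  obtain ⟨φ, hφ⟩ := h₁
  obtain ⟨ψ, hψ⟩ := h₂
  refine ⟨φ ∘ ψ, fun C hC => ?_⟩
  rw [Set.image_comp]
  exact hφ _ (hψ _ hC)

/-- A monotone map between the members of two filters whose values are arbitrarily small witnesses
the Tukey order. -/
theorem TukeyLE.of_filter {α β : Type*} {l : Filter α} {m : Filter β} (φ : Set α → Set β)
    (hφ : Monotone φ) (hmem : ∀ U ∈ l, φ U ∈ m) (hsub : ∀ V ∈ m, ∃ U ∈ l, φ U ⊆ V) :
    TukeyLE (FilterPoset m) (FilterPoset l) := by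
  refine TukeyLE.of_monotone
    (fun U => OrderDual.toDual ⟨φ (OrderDual.ofDual U).1, hmem _ (OrderDual.ofDual U).2⟩) ?_ ?_
  · intro U V hUV
    exact hφ hUV
  · intro V
    obtain ⟨U, hU, hUV⟩ := hsub _ (OrderDual.ofDual V).2
    exact ⟨OrderDual.toDual ⟨U, hU⟩, hUV⟩

/-! ### Uniform `P`-spaces -/

theorem IsUniformPSpace.iInter_mem {X ι : Type*} [UniformSpace X] [Countable ι]
    (hP : IsUniformPSpace X) {U : ι → Set (X × X)} (hU : ∀ i, U i ∈ 𝓤 X) : ⋂ i, U i ∈ 𝓤 X := by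
  rw [← Set.sInter_range]
  exact hP _ (Set.countable_range U) (Set.forall_mem_range.2 hU)

/-- In a uniform `P`-space the equivalence relations form a base of the uniformity. -/
theorem IsUniformPSpace.exists_setoid {X : Type*} [UniformSpace X] (hP : IsUniformPSpace X)
    {U : Set (X × X)} (hU : U ∈ 𝓤 X) :
    ∃ E : Setoid X, {p : X × X | E p.1 p.2} ∈ 𝓤 X ∧ ∀ x y, E x y → (x, y) ∈ U := by
  have h : ∀ V : {V // V ∈ 𝓤 X}, ∃ W : {W // W ∈ 𝓤 X},
      (∀ x y, (x, y) ∈ W.1 → (y, x) ∈ V.1) ∧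
      ∀ x y z, (x, y) ∈ W.1 → (y, z) ∈ W.1 → (x, z) ∈ V.1 := by
    rintro ⟨V, hV⟩
    obtain ⟨W, hW, hWs, hWV⟩ := comp_symm_mem_uniformity_sets hV
    refine ⟨⟨W, hW⟩, fun x y hxy => ?_, fun x y z hxy hyz => hWV ⟨y, hxy, hyz⟩⟩
    exact hWV ⟨x, hWs.symm _ _ hxy, refl_mem_uniformity hW⟩
  choose f hfs hft using h
  let V : ℕ → {V // V ∈ 𝓤 X} := fun n => f^[n] ⟨U, hU⟩
  have hV : ∀ n, V (n + 1) = f (V n) := fun n => Function.iterate_succ_apply' f n _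
  refine ⟨⟨fun x y => ∀ n, (x, y) ∈ (V n).1, fun x n => refl_mem_uniformity (V n).2,
    fun {x y} hxy n => hfs (V n) x y (hV n ▸ hxy (n + 1)),
    fun {x y z} hxy hyz n => hft (V n) x y z (hV n ▸ hxy (n + 1)) (hV n ▸ hyz (n + 1))⟩, ?_,
    fun x y hxy => hxy 0⟩
  convert hP.iInter_mem fun n => (V n).2 using 1
  ext p
  exact Set.mem_iInter.symm

/-! ### Subgroups inside neighbourhoods of the identity -/

/-- Every neighbourhood of the identity contains a subgroup that is a countable intersection of
neighbourhoods of the identity. -/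
@[to_additive /-- Every neighbourhood of zero contains a subgroup that is a countable intersection
of neighbourhoods of zero. -/]
theorem exists_subgroup_eq_iInter_nhds_one {G : Type*} [Group G] [TopologicalSpace G]
    [IsTopologicalGroup G] {V : Set G} (hV : V ∈ 𝓝 (1 : G)) :
    ∃ (H : Subgroup G) (W : ℕ → Set G), (∀ n, W n ∈ 𝓝 (1 : G)) ∧ (H : Set G) = ⋂ n, W n ∧
      (H : Set G) ⊆ V := by
  have h : ∀ S : {S // S ∈ 𝓝 (1 : G)}, ∃ T : {T // T ∈ 𝓝 (1 : G)},
      (∀ x ∈ T.1, x⁻¹ ∈ S.1) ∧ ∀ x ∈ T.1, ∀ y ∈ T.1, x * y ∈ S.1 := by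
    rintro ⟨S, hS⟩
    obtain ⟨T, hT, hTS⟩ := exists_nhds_one_split hS
    refine ⟨⟨T ∩ (fun x => x⁻¹) ⁻¹' S, Filter.inter_mem hT ?_⟩, fun x hx => hx.2,
      fun x hx y hy => hTS x hx.1 y hy.1⟩
    exact continuous_inv.continuousAt.preimage_mem_nhds (by simpa using hS)
  choose f hfi hfm using h
  let W : ℕ → {S // S ∈ 𝓝 (1 : G)} := fun n => f^[n] ⟨V, hV⟩
  have hW : ∀ n, W (n + 1) = f (W n) := fun n => Function.iterate_succ_apply' f n _
  refine ⟨
    { carrier := ⋂ n, (W n).1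
      one_mem' := Set.mem_iInter.2 fun n => mem_of_mem_nhds (W n).2
      mul_mem' := fun {x y} hx hy => Set.mem_iInter.2 fun n =>
        hfm (W n) x (hW n ▸ Set.mem_iInter.1 hx (n + 1)) y (hW n ▸ Set.mem_iInter.1 hy (n + 1))
      inv_mem' := fun {x} hx => Set.mem_iInter.2 fun n =>
        hfi (W n) x (hW n ▸ Set.mem_iInter.1 hx (n + 1)) },
    fun n => (W n).1, fun n => (W n).2, rfl, Set.iInter_subset (fun n => (W n).1) 0⟩

/-! ### Subgroups of the free group and entourages -/

/-- The pairs of generators that a subgroup of the free group identifies on both sides. -/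
def generatorRel {X : Type*} (K : Subgroup (FreeGroup X)) : Set (X × X) :=
  {p | (FreeGroup.of p.1)⁻¹ * FreeGroup.of p.2 ∈ K ∧ FreeGroup.of p.2 * (FreeGroup.of p.1)⁻¹ ∈ K}

/-- If every conjugate of a subgroup of the free group over an `ω`-narrow space identifies the
pairs of generators in some entourage, then the subgroup has countable index. -/
theorem countable_quotient_of_generatorRel_mem {X : Type*} [UniformSpace X]
    (hnarrow : IsOmegaNarrow X) (H : Subgroup (FreeGroup X))
    (hH : ∀ g : FreeGroup X, generatorRel (H.map (MulAut.conj g).toMonoidHom) ∈ 𝓤 X) :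
    Countable (FreeGroup X ⧸ H) := by
  have hconj : ∀ g a b : FreeGroup X, a⁻¹ * b ∈ H.map (MulAut.conj g).toMonoidHom →
      ((a * g : FreeGroup X) : FreeGroup X ⧸ H) = (b * g : FreeGroup X) := by
    rintro g a b ⟨h, hh, hab⟩
    rw [QuotientGroup.eq]
    have : (a * g)⁻¹ * (b * g) = h := by
      rw [mul_inv_rev, mul_assoc, ← mul_assoc a⁻¹, ← hab]
      simp [mul_assoc]
    rwa [this]
  have hstep : ∀ c : FreeGroup X ⧸ H, ((Set.range fun x : X => FreeGroup.of x • c) ∪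
      Set.range fun x : X => (FreeGroup.of x)⁻¹ • c).Countable := by
    intro c
    obtain ⟨g, rfl⟩ := QuotientGroup.mk_surjective c
    obtain ⟨A, hA, hcov⟩ := hnarrow _ (hH g)
    have hx : ∀ x, ∃ a ∈ A, (a, x) ∈ generatorRel (H.map (MulAut.conj g).toMonoidHom) := by
      intro x
      have := hcov.ge (Set.mem_univ x)
      simpa [UniformSpace.ball] using this
    refine ((hA.image fun x : X => FreeGroup.of x • (g : FreeGroup X ⧸ H)).mono ?_).union
      ((hA.image fun x : X => (FreeGroup.of x)⁻¹ • (g : FreeGroup X ⧸ H)).mono ?_)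
    · rintro _ ⟨x, rfl⟩
      obtain ⟨a, ha, hax⟩ := hx x
      exact ⟨a, ha, hconj g _ _ hax.1⟩
    · rintro _ ⟨x, rfl⟩
      obtain ⟨a, ha, hax⟩ := hx x
      refine ⟨a, ha, (hconj g _ _ ?_).symm⟩
      simpa using hax.2
  let S : ℕ → Set (FreeGroup X ⧸ H) := fun n => Nat.rec {((1 : FreeGroup X) : FreeGroup X ⧸ H)}
    (fun _ T => ⋃ c ∈ T, ((Set.range fun x : X => FreeGroup.of x • c) ∪
      Set.range fun x : X => (FreeGroup.of x)⁻¹ • c)) n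
  have hS : (⋃ n, S n).Countable := by
    refine Set.countable_iUnion fun n => ?_
    induction n with
    | zero => exact Set.countable_singleton _
    | succ n ih => exact ih.biUnion fun c _ => hstep c
  have hof : ∀ x : X, ∀ c ∈ ⋃ n, S n, FreeGroup.of x • c ∈ ⋃ n, S n := by
    intro x c hc
    obtain ⟨n, hn⟩ := Set.mem_iUnion.1 hc
    exact Set.mem_iUnion.2 ⟨n + 1, Set.mem_biUnion hn (Or.inl ⟨x, rfl⟩)⟩
  have hinv : ∀ x : X, ∀ c ∈ ⋃ n, S n, (FreeGroup.of x)⁻¹ • c ∈ ⋃ n, S n := by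
    intro x c hc
    obtain ⟨n, hn⟩ := Set.mem_iUnion.1 hc
    exact Set.mem_iUnion.2 ⟨n + 1, Set.mem_biUnion hn (Or.inr ⟨x, rfl⟩)⟩
  have hall : ∀ g : FreeGroup X, ∀ c ∈ ⋃ n, S n, g • c ∈ ⋃ n, S n := by
    intro g
    induction g using FreeGroup.induction_on with
    | C1 => intro c hc; rwa [one_smul]
    | of x => exact hof x
    | inv_of x _ => exact hinv x
    | mul a b ha hb => intro c hc; rw [mul_smul]; exact ha _ (hb _ hc)
  rw [← Set.countable_univ_iff]
  refine hS.mono fun c _ => ?_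
  obtain ⟨g, rfl⟩ := QuotientGroup.mk_surjective c
  simpa using hall g _ (Set.mem_iUnion.2 ⟨0, Set.mem_singleton _⟩)

/-- Under the hypotheses of countable index, the normal core of the subgroup identifies the pairs
of generators in some entourage. -/
theorem generatorRel_normalCore_mem {X : Type*} [UniformSpace X] (hnarrow : IsOmegaNarrow X)
    (hP : IsUniformPSpace X) (H : Subgroup (FreeGroup X))
    (hH : ∀ g : FreeGroup X, generatorRel (H.map (MulAut.conj g).toMonoidHom) ∈ 𝓤 X) :
    generatorRel H.normalCore ∈ 𝓤 X := by
  have := countable_quotient_of_generatorRel_mem hnarrow H hH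
  have hcore : ∀ k : FreeGroup X, (∀ c : FreeGroup X ⧸ H,
      k ∈ H.map (MulAut.conj c.out).toMonoidHom) → k ∈ H.normalCore := by
    intro k hk g
    obtain ⟨h, hh⟩ := QuotientGroup.mk_out_eq_mul H g⁻¹
    obtain ⟨h', hh', hk'⟩ := hk (g⁻¹ : FreeGroup X)
    rw [hh] at hk'
    have : g * k * g⁻¹ = h * h' * (h : FreeGroup X)⁻¹ := by
      rw [← hk']
      simp [mul_assoc]
    rw [this]
    exact H.mul_mem (H.mul_mem h.2 hh') (H.inv_mem h.2)
  refine Filter.mem_of_superset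
    (hP.iInter_mem fun c : FreeGroup X ⧸ H => hH c.out) fun p hp => ⟨hcore _ fun c => ?_,
      hcore _ fun c => ?_⟩
  exacts [(Set.mem_iInter.1 hp c).1, (Set.mem_iInter.1 hp c).2]

/-- The normal subgroup of the free group generated by the quotients of pairs in a relation. -/
def relNormalClosure {X : Type*} (U : Set (X × X)) : Subgroup (FreeGroup X) :=
  Subgroup.normalClosure ((fun p : X × X => (FreeGroup.of p.1)⁻¹ * FreeGroup.of p.2) '' U)

instance {X : Type*} (U : Set (X × X)) : (relNormalClosure U).Normal :=
  Subgroup.normalClosure_normal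

/-- The subgroup of the free abelian group generated by the differences of pairs in a relation. -/
def relClosure {X : Type*} (U : Set (X × X)) : AddSubgroup (FreeAbelianGroup X) :=
  AddSubgroup.closure
    ((fun p : X × X => -FreeAbelianGroup.of p.1 + FreeAbelianGroup.of p.2) '' U)

/-! ### Neighbourhoods of the identity in the free topological groups -/

/-- The kernel of a homomorphism that identifies the pairs of generators in an entourage is a
neighbourhood of the identity. -/
theorem ker_lift_mem_nhds {X G : Type*} [UniformSpace X] [Group G] (f : X → G)
    (hf : {p : X × X | f p.1 = f p.2} ∈ 𝓤 X) :
    ((FreeGroup.lift f).ker : Set (FreeGroup X)) ∈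
      @nhds (FreeGroup X) (freeGroupTopology X).toTopologicalSpace 1 := by
  let t : GroupTopology G := ⊥
  have hu : UniformContinuousTwoSided t f := by
    rw [uniformContinuousTwoSided_iff]
    constructor <;> intro V hV <;> rw [Filter.mem_map] <;>
      refine Filter.mem_of_superset hf fun p hp => ?_ <;>
      simpa [show f p.1 = f p.2 from hp] using @mem_of_mem_nhds G t.toTopologicalSpace _ _ hV
  have hc := continuous_freeGroup_lift t f hu
  let := (freeGroupTopology X).toTopologicalSpace
  let : TopologicalSpace G := t.toTopologicalSpace
  have : DiscreteTopology G := ⟨rfl⟩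
  exact ((isOpen_discrete ({1} : Set G)).preimage hc).mem_nhds (map_one (FreeGroup.lift f))

theorem ker_abelian_lift_mem_nhds {X G : Type*} [UniformSpace X] [AddCommGroup G] (f : X → G)
    (hf : {p : X × X | f p.1 = f p.2} ∈ 𝓤 X) :
    ((FreeAbelianGroup.lift f).ker : Set (FreeAbelianGroup X)) ∈
      @nhds (FreeAbelianGroup X) (freeAbelianGroupTopology X).toTopologicalSpace 0 := by
  let t : AddGroupTopology G := ⊥
  have hu : AddUniformContinuousTwoSided t f := by
    rw [addUniformContinuousTwoSided_iff]
    constructor <;> intro V hV <;> rw [Filter.mem_map] <;>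
      refine Filter.mem_of_superset hf fun p hp => ?_ <;>
      simpa [show f p.1 = f p.2 from hp] using @mem_of_mem_nhds G t.toTopologicalSpace _ _ hV
  have hc := continuous_freeAbelianGroup_lift t f hu
  let := (freeAbelianGroupTopology X).toTopologicalSpace
  let : TopologicalSpace G := t.toTopologicalSpace
  have : DiscreteTopology G := ⟨rfl⟩
  exact ((isOpen_discrete ({0} : Set G)).preimage hc).mem_nhds
    (map_zero (FreeAbelianGroup.lift f))

theorem relNormalClosure_mem_nhds {X : Type*} [UniformSpace X] {U : Set (X × X)} (hU : U ∈ 𝓤 X) :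
    (relNormalClosure U : Set (FreeGroup X)) ∈
      @nhds (FreeGroup X) (freeGroupTopology X).toTopologicalSpace 1 := by
  have h := ker_lift_mem_nhds
    (fun x => (FreeGroup.of x : FreeGroup X ⧸ relNormalClosure U))
    (Filter.mem_of_superset hU fun p hp =>
      QuotientGroup.eq.2 (Subgroup.subset_normalClosure (Set.mem_image_of_mem
        (fun p : X × X => (FreeGroup.of p.1)⁻¹ * FreeGroup.of p.2) hp)))
  have hlift : FreeGroup.lift (fun x => (FreeGroup.of x : FreeGroup X ⧸ relNormalClosure U)) =
      QuotientGroup.mk' (relNormalClosure U) := by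
    ext x
    simp
  rwa [hlift, QuotientGroup.ker_mk'] at h

theorem relClosure_mem_nhds {X : Type*} [UniformSpace X] {U : Set (X × X)} (hU : U ∈ 𝓤 X) :
    (relClosure U : Set (FreeAbelianGroup X)) ∈
      @nhds (FreeAbelianGroup X) (freeAbelianGroupTopology X).toTopologicalSpace 0 := by
  have h := ker_abelian_lift_mem_nhds
    (fun x => (FreeAbelianGroup.of x : FreeAbelianGroup X ⧸ relClosure U))
    (Filter.mem_of_superset hU fun p hp =>
      QuotientAddGroup.eq.2 (AddSubgroup.subset_closure (Set.mem_image_of_mem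
        (fun p : X × X => -FreeAbelianGroup.of p.1 + FreeAbelianGroup.of p.2) hp)))
  have hlift : FreeAbelianGroup.lift
      (fun x => (FreeAbelianGroup.of x : FreeAbelianGroup X ⧸ relClosure U)) =
      QuotientAddGroup.mk' (relClosure U) := by
    ext x
    simp
  rwa [hlift, QuotientAddGroup.ker_mk'] at h

theorem exists_relNormalClosure_subset {X : Type*} [UniformSpace X] (hnarrow : IsOmegaNarrow X)
    (hP : IsUniformPSpace X) {V : Set (FreeGroup X)}
    (hV : V ∈ @nhds (FreeGroup X) (freeGroupTopology X).toTopologicalSpace 1) :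
    ∃ U ∈ 𝓤 X, (relNormalClosure U : Set (FreeGroup X)) ⊆ V := by
  obtain ⟨hl, hr⟩ := (uniformContinuousTwoSided_iff _ _).1
    (uniformContinuousTwoSided_freeGroup_of X)
  let := (freeGroupTopology X).toTopologicalSpace
  have := (freeGroupTopology X).toIsTopologicalGroup
  obtain ⟨H, W, hW, hHW, hHV⟩ := exists_subgroup_eq_iInter_nhds_one hV
  have hH : ∀ g : FreeGroup X, generatorRel (H.map (MulAut.conj g).toMonoidHom) ∈ 𝓤 X := by
    intro g
    have hc : ∀ n, (fun x : FreeGroup X => g⁻¹ * x * g) ⁻¹' W n ∈ 𝓝 (1 : FreeGroup X) := by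
      intro n
      have : Continuous fun x : FreeGroup X => g⁻¹ * x * g := by fun_prop
      exact this.continuousAt.preimage_mem_nhds (by simpa using hW n)
    have hmem : ∀ k : FreeGroup X, (∀ n, g⁻¹ * k * g ∈ W n) →
        k ∈ H.map (MulAut.conj g).toMonoidHom := by
      intro k hk
      have hk' : g⁻¹ * k * g ∈ (H : Set (FreeGroup X)) := hHW ▸ Set.mem_iInter.2 hk
      exact ⟨_, hk', by simp [mul_assoc]⟩
    refine Filter.mem_of_superset
      (hP.iInter_mem fun n => Filter.inter_mem (hl (hc n)) (hr (hc n))) fun p hp =>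
        ⟨hmem _ fun n => ?_, hmem _ fun n => ?_⟩
    exacts [(Set.mem_iInter.1 hp n).1, (Set.mem_iInter.1 hp n).2]
  refine ⟨_, generatorRel_normalCore_mem hnarrow hP H hH, ?_⟩
  have hle : relNormalClosure (generatorRel H.normalCore) ≤ H.normalCore := by
    refine Subgroup.normalClosure_le_normal ?_
    rintro _ ⟨p, hp, rfl⟩
    exact hp.1
  exact fun x hx => hHV (H.normalCore_le (hle hx))

theorem exists_relClosure_subset {X : Type*} [UniformSpace X] (hP : IsUniformPSpace X)
    {V : Set (FreeAbelianGroup X)}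
    (hV : V ∈ @nhds (FreeAbelianGroup X) (freeAbelianGroupTopology X).toTopologicalSpace 0) :
    ∃ U ∈ 𝓤 X, (relClosure U : Set (FreeAbelianGroup X)) ⊆ V := by
  have hl := ((addUniformContinuousTwoSided_iff _ _).1
    (addUniformContinuousTwoSided_freeAbelianGroup_of X)).1
  let := (freeAbelianGroupTopology X).toTopologicalSpace
  have := (freeAbelianGroupTopology X).toIsTopologicalAddGroup
  obtain ⟨H, W, hW, hHW, hHV⟩ := exists_addSubgroup_eq_iInter_nhds_zero hV
  refine ⟨_, hP.iInter_mem fun n => hl (hW n), fun x hx => hHV ?_⟩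
  refine (AddSubgroup.closure_le H).2 ?_ hx
  rintro _ ⟨p, hp, rfl⟩
  rw [hHW]
  exact Set.mem_iInter.2 fun n => Set.mem_iInter.1 hp n

/-! ### Comparison with the uniformity -/

theorem freeGroupNhds_tukeyLE {X : Type*} [UniformSpace X] (hnarrow : IsOmegaNarrow X)
    (hP : IsUniformPSpace X) : TukeyLE (FreeGroupNhds X) (FilterPoset (𝓤 X)) :=
  TukeyLE.of_filter (fun U => (relNormalClosure U : Set (FreeGroup X)))
    (fun _ _ h => Subgroup.normalClosure_mono (Set.image_mono h))
    (fun _ => relNormalClosure_mem_nhds) fun _ => exists_relNormalClosure_subset hnarrow hP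

theorem freeAbelianGroupNhds_tukeyLE {X : Type*} [UniformSpace X] (hP : IsUniformPSpace X) :
    TukeyLE (FreeAbelianGroupNhds X) (FilterPoset (𝓤 X)) :=
  TukeyLE.of_filter (fun U => (relClosure U : Set (FreeAbelianGroup X)))
    (fun _ _ h => AddSubgroup.closure_mono (Set.image_mono h))
    (fun _ => relClosure_mem_nhds) fun _ => exists_relClosure_subset hP

theorem tukeyLE_freeGroupNhds {X : Type*} [UniformSpace X] (hP : IsUniformPSpace X) :
    TukeyLE (FilterPoset (𝓤 X)) (FreeGroupNhds X) := by
  refine TukeyLE.of_filter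
    (fun V => (fun p : X × X => (FreeGroup.of p.1)⁻¹ * FreeGroup.of p.2) ⁻¹' V)
    (fun _ _ h => Set.preimage_mono h)
    (fun V hV => ((uniformContinuousTwoSided_iff _ _).1
      (uniformContinuousTwoSided_freeGroup_of X)).1 hV) fun U hU => ?_
  obtain ⟨E, hE, hEU⟩ := hP.exists_setoid hU
  refine ⟨_, ker_lift_mem_nhds (fun x => FreeGroup.of (Quotient.mk E x))
    (Filter.mem_of_superset hE fun p hp => congrArg FreeGroup.of (Quotient.sound hp)), ?_⟩
  rintro ⟨x, y⟩ hxy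
  have h : (FreeGroup.of (Quotient.mk E x))⁻¹ * FreeGroup.of (Quotient.mk E y) = 1 := by
    simpa using hxy
  exact hEU x y (Quotient.exact (FreeGroup.of_injective (inv_mul_eq_one.1 h)))

theorem tukeyLE_freeAbelianGroupNhds {X : Type*} [UniformSpace X] (hP : IsUniformPSpace X) :
    TukeyLE (FilterPoset (𝓤 X)) (FreeAbelianGroupNhds X) := by
  refine TukeyLE.of_filter
    (fun V => (fun p : X × X => -FreeAbelianGroup.of p.1 + FreeAbelianGroup.of p.2) ⁻¹' V)
    (fun _ _ h => Set.preimage_mono h)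
    (fun V hV => ((addUniformContinuousTwoSided_iff _ _).1
      (addUniformContinuousTwoSided_freeAbelianGroup_of X)).1 hV) fun U hU => ?_
  obtain ⟨E, hE, hEU⟩ := hP.exists_setoid hU
  refine ⟨_, ker_abelian_lift_mem_nhds (fun x => FreeAbelianGroup.of (Quotient.mk E x))
    (Filter.mem_of_superset hE fun p hp => congrArg FreeAbelianGroup.of (Quotient.sound hp)), ?_⟩
  rintro ⟨x, y⟩ hxy
  have h : -FreeAbelianGroup.of (Quotient.mk E x) + FreeAbelianGroup.of (Quotient.mk E y) = 0 := by
    simpa using hxy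
  exact hEU x y (Quotient.exact (FreeAbelianGroup.of_injective (neg_add_eq_zero.1 h)))

theorem mainTheorem12 {X : Type*} [UniformSpace X] [T0Space X]
    (hnarrow : IsOmegaNarrow X) (hP : IsUniformPSpace X) :
    TukeyEquiv (FreeGroupNhds X) (FreeAbelianGroupNhds X) ∧
      TukeyEquiv (FreeAbelianGroupNhds X) (FilterPoset (𝓤 X)) :=
  ⟨⟨(freeGroupNhds_tukeyLE hnarrow hP).trans (tukeyLE_freeAbelianGroupNhds hP),
    (freeAbelianGroupNhds_tukeyLE hP).trans (tukeyLE_freeGroupNhds hP)⟩,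
    freeAbelianGroupNhds_tukeyLE hP, tukeyLE_freeAbelianGroupNhds hP⟩
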